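/- Let $k$ be a field of characteristic zero. Let $\mathcal{G}$ be the category whose objects are finite groups and whose morphisms are conjugacy classes of surjective homomorphisms, where $\varphi,\psi\colon G\to H$ are conjugate if there is $h\in H$ with $\psi(x)=h\varphi(x)h^{-1}$ for all $x\in G$. For a full subcategory $\mathcal{U}\leq\mathcal{G}$ closed under isomorphism, let $\mathcal{A}\,\mathcal{U}=[\mathcal{U}^{\mathrm{op}},\mathrm{Vect}_k]$ be the category of contravariant functors from $\mathcal{U}$ to $k$-vector spaces, and for $G\in\mathcal{U}$ let $e_G=k[\mathcal{U}(-,G)]\in\mathcal{A}\,\mathcal{U}$. An object $X$ of $\mathcal{A}\,\mathcal{U}$ is finitely generated if there is an epimorphism $\bigoplus_{i=1}^{m}e_{G_i}\to X$ for some $m\geq 0$ and $G_1,\dots,G_m\in\mathcal{U}$. The category $\mathcal{A}\,\mathcal{U}$ is locally noetherian if for every $G\in\mathcal{U}$ every subobject of $e_G$ is finitely generated. Call $\mathcal{U}$ multiplicative if it contains the trivial group and is closed under binary products, and a global family if it is closed under passage to subgroups and to quotient groups. Theorem. Let $p$ be a prime number. 1. If $\mathcal{Z}[p^\infty]$ denotes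 the full subcategory of finite abelian $p$-groups, then $\mathcal{A}\,\mathcal{Z}[p^\infty]$ is locally noetherian. 2. For every integer $n\geq 1$, if $\mathcal{Z}[p^n]$ denotes the full subcategory of finite abelian groups of exponent dividing $p^n$, then $\mathcal{A}\,\mathcal{Z}[p^n]$ is locally noetherian. 3. More generally, if $\mathcal{U}$ is any multiplicative global family of finite abelian $p$-groups, then $\mathcal{A}\,\mathcal{U}$ is locally noetherian. -/

import Mathlib

open CategoryTheory CategoryTheory.Limits

universe u

/-- Finite groups, as objects of the category whose morphisms are conjugacy classes of surjective
homomorphisms. -/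
structure OutGrp : Type (u + 1) where
  /-- the underlying type -/
  carrier : Type u
  [group : Group carrier]
  [finite : Finite carrier]

namespace OutGrp

instance : CoeSort OutGrp.{u} (Type u) := ⟨OutGrp.carrier⟩

instance (G : OutGrp.{u}) : Group G := G.group

instance (G : OutGrp.{u}) : Finite G := G.finite

/-- A finite group, regarded as an object of `OutGrp`. -/
abbrev of (G : Type u) [Group G] [Finite G] : OutGrp.{u} := ⟨G⟩

/-- Surjective group homomorphisms. -/
abbrev Surj (G H : OutGrp.{u}) : Type u := {f : G →* H // Function.Surjective f}

/-- `f` and `g` are conjugate if `g = c_h ∘ f` for some `h`, where `c_h x = h * x * h⁻¹`. -/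
def conjSetoid (G H : OutGrp.{u}) : Setoid (Surj G H) where
  r f g := ∃ h : H, g.1 = (MulAut.conj h).toMonoidHom.comp f.1
  iseqv :=
    { refl := fun f => ⟨1, by ext x; simp⟩
      symm := by
        rintro f g ⟨h, hg⟩
        refine ⟨h⁻¹, ?_⟩
        ext x
        simp [hg, mul_assoc]
      trans := by
        rintro f g l ⟨h, hg⟩ ⟨h', hl⟩
        refine ⟨h' * h, ?_⟩
        ext x
        simp [hg, hl, mul_assoc] }

/-- Conjugacy classes of surjective homomorphisms. -/
def Hom (G H : OutGrp.{u}) : Type u := Quotient (conjSetoid G H)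

/-- Composition of conjugacy classes, induced by composition of homomorphisms. -/
def Hom.comp {G H K : OutGrp.{u}} : Hom G H → Hom H K → Hom G K :=
  Quotient.map₂ (fun f g => ⟨g.1.comp f.1, g.2.comp f.2⟩) (by
    rintro f f' ⟨h, hf⟩ g g' ⟨k, hg⟩
    refine ⟨k * g.1 h, ?_⟩
    ext x
    simp [hf, hg, mul_assoc])

instance : Category.{u} OutGrp.{u} where
  Hom G H := Hom G H
  id G := Quotient.mk (conjSetoid G G) ⟨MonoidHom.id G, Function.surjective_id⟩
  comp f g := Hom.comp f g
  id_comp := by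
    rintro G H ⟨f⟩
    rfl
  comp_id := by
    rintro G H ⟨f⟩
    rfl
  assoc := by
    rintro G H K L ⟨f⟩ ⟨g⟩ ⟨h⟩
    rfl

end OutGrp

/-- `𝒰` contains the trivial group and is closed under binary products. -/
structure IsMultiplicative (U : ObjectProperty OutGrp.{u}) : Prop where
  one_mem : U (OutGrp.of PUnit.{u + 1})
  prod_mem : ∀ G H : OutGrp.{u}, U G → U H → U (OutGrp.of (G × H))

/-- `𝒰` is closed under passage to subgroups and to quotients (in particular it is closed under
isomorphism). -/
structure IsGlobalFamily (U : ObjectProperty OutGrp.{u}) : Prop where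
  subgroup_mem : ∀ (G : OutGrp.{u}) (H : Subgroup G), U G → U (OutGrp.of H)
  quotient_mem : ∀ (G H : OutGrp.{u}) (f : G →* H), Function.Surjective f → U G → U H

/-- The family `𝒵[p^∞]` of finite abelian `p`-groups. -/
def abelianPGroups (p : ℕ) : ObjectProperty OutGrp.{u} :=
  fun G => (∀ x y : G, x * y = y * x) ∧ IsPGroup p G

/-- The family `𝒵[m]` of finite abelian groups of exponent dividing `m`. -/
def abelianOfExponentDvd (m : ℕ) : ObjectProperty OutGrp.{u} :=
  fun G => (∀ x y : G, x * y = y * x) ∧ Monoid.exponent G ∣ m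

/-- The category `𝒜𝒰` of contravariant functors from the full subcategory `𝒰` to vector spaces
over `k`. -/
abbrev FunctorCat (k : Type u) [Field k] (U : ObjectProperty OutGrp.{u}) :=
  U.FullSubcategoryᵒᵖ ⥤ ModuleCat.{u} k

/-- The representable object `e_G = k[𝒰(-, G)]`. -/
noncomputable def repObj (k : Type u) [Field k] (U : ObjectProperty OutGrp.{u})
    (G : U.FullSubcategory) : FunctorCat.{u} k U :=
  yoneda.obj G ⋙ ModuleCat.free k

/-- `X` is a quotient of a finite direct sum of representables `e_{G_1} ⊕ ⋯ ⊕ e_{G_n}`. -/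
def IsFinitelyGenerated {k : Type u} [Field k] {U : ObjectProperty OutGrp.{u}}
    (X : FunctorCat.{u} k U) : Prop :=
  ∃ (n : ℕ) (G : Fin n → U.FullSubcategory)
    (f : (∐ fun i => repObj k U (G i)) ⟶ X), Epi f

/-- Every subobject of `X` is finitely generated. -/
def IsNoetherianObj {k : Type u} [Field k] {U : ObjectProperty OutGrp.{u}}
    (X : FunctorCat.{u} k U) : Prop :=
  ∀ S : Subobject X, IsFinitelyGenerated (S : FunctorCat.{u} k U)

/-- `𝒜𝒰` is locally noetherian: all representables `e_G` are noetherian. -/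
def IsLocallyNoetherian (k : Type u) [Field k] (U : ObjectProperty OutGrp.{u}) : Prop :=
  ∀ G : U.FullSubcategory, IsNoetherianObj (repObj k U G)

/-! The proof is a Gröbner basis argument. Conjugation in an abelian `G` is trivial, so a morphism
`H ⟶ G` is a homomorphism, hence a word in the finite alphabet `G`: its values on a basis of `H`
sorted by order. Words of equal length are compared lexicographically.

A surjection of index sets that does not increase exponents induces a surjection of groups. If it is
ordered, precomposition is strictly monotone on words (`IsOrderedSurj.lex_lt`) and so carries
leading terms to leading terms. By Higman's lemma the words are well-quasi-ordered under such
surjections (`exists_lt_isOrderedSurj`). Hence finitely many leading terms of a subfunctor of `e_G`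
yield all the others, and reduction modulo elements with these leading terms shows that they
generate it (`exists_finite_generators`). -/

/-! ### Well-quasi-orders and ordered surjections of words -/

/-- Every subset of a well-quasi-order is dominated from below by finitely many of its elements. -/
theorem WellQuasiOrdered.exists_finset_basis {α : Type*} {r : α → α → Prop}
    (h : WellQuasiOrdered r) (s : Set α) :
    ∃ t : Finset α, (∀ y ∈ t, y ∈ s) ∧ ∀ x ∈ s, ∃ y ∈ t, r y x := by
  by_contra! hc
  -- If no finite subset dominates `s`, elements can be chosen one by one, none above an earlier
  -- one: a bad sequence.
  obtain ⟨f, -, hf⟩ := exists_seq_of_forall_finset_exists (· ∈ s) (fun x y => ¬ r x y)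
    (fun t ht => (hc t ht).imp fun y hy => hy)
  obtain ⟨m, n, hmn, hr⟩ := h f
  exact hf m n hmn hr

/-- `σ : [n] → [m]` is an ordered surjection if the first preimage of `j` comes before
every preimage of a later index. -/
def IsOrderedSurj {m n : ℕ} (σ : Fin n → Fin m) : Prop :=
  ∀ j, ∃ i, σ i = j ∧ ∀ i' < i, σ i' < j

theorem IsOrderedSurj.surjective {m n : ℕ} {σ : Fin n → Fin m} (h : IsOrderedSurj σ) :
    Function.Surjective σ :=
  fun j => (h j).imp fun _ hi => hi.1

/-- Pulling back along an ordered surjection is strictly monotone for the lexicographic order. -/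
theorem IsOrderedSurj.lex_lt {G : Type*} [LinearOrder G] {m n : ℕ} {σ : Fin n → Fin m}
    (h : IsOrderedSurj σ) {v w : Fin m → G} (hvw : toLex v < toLex w) :
    toLex (v ∘ σ) < toLex (w ∘ σ) := by
  obtain ⟨j, hj, hlt⟩ := hvw
  obtain ⟨i, rfl, hi⟩ := h j
  exact ⟨i, fun i' hi' => hj _ (hi i' hi'), hlt⟩

/-- The letter in position `i` occurs there for the first time. -/
def IsFirstOccurrence {G : Type*} {m : ℕ} (g : Fin m → G) (i : Fin m) : Prop :=
  ∀ j < i, g j ≠ g i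

theorem exists_isFirstOccurrence {G : Type*} {m : ℕ} (g : Fin m → G) (i : Fin m) :
    ∃ j, g j = g i ∧ IsFirstOccurrence g j := by
  induction i using WellFoundedLT.induction with
  | _ i ih =>
    by_cases h : IsFirstOccurrence g i
    · exact ⟨i, rfl, h⟩
    · simp only [IsFirstOccurrence, not_forall, not_not] at h
      obtain ⟨j, hj, hji⟩ := h
      obtain ⟨l, hl, hfirst⟩ := ih j hj
      exact ⟨l, hl.trans hji, hfirst⟩

/-- An embedding of words with monotone weights that preserves letters and first occurrences
has an ordered surjection as a retraction. -/
theorem exists_isOrderedSurj_of_orderEmbedding {G : Type*} {m n : ℕ} {g : Fin m → G}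
    {g' : Fin n → G} {b : Fin m → ℕ} {b' : Fin n → ℕ} (hb' : Monotone b')
    (hrange : Set.range g' ⊆ Set.range g) (f : Fin m ↪o Fin n) (hg : ∀ i, g' (f i) = g i)
    (hb : ∀ i, b i ≤ b' (f i))
    (hfirst : ∀ i, IsFirstOccurrence g i → IsFirstOccurrence g' (f i)) :
    ∃ σ : Fin n → Fin m, IsOrderedSurj σ ∧ (∀ i, g (σ i) = g' i) ∧ ∀ i, b (σ i) ≤ b' i := by
  -- A position outside the image of `f` is sent to the first occurrence `j` of its letter in `g`.
  -- Since `f j` is then a first occurrence in `g'`, it cannot come after `i`.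
  have key : ∀ i, ∃ j, f j ≤ i ∧ g j = g' i ∧ ∀ l, f l = i → j = l := by
    intro i
    by_cases hi : ∃ l, f l = i
    · obtain ⟨l, rfl⟩ := hi
      exact ⟨l, le_rfl, (hg l).symm, fun l' hl' => (f.injective hl').symm⟩
    · obtain ⟨l, hl⟩ := hrange ⟨i, rfl⟩
      obtain ⟨j, hj, hj'⟩ := exists_isFirstOccurrence g l
      refine ⟨j, ?_, hj.trans hl, fun l' hl' => absurd ⟨l', hl'⟩ hi⟩
      by_contra! hlt
      exact hfirst j hj' i hlt (by rw [hg, hj, hl])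
  choose σ hσ₁ hσ₂ hσ₃ using key
  -- The inequality `f (σ i) ≤ i` makes `f j` the first preimage of `j`; with `b'` monotone it also
  -- bounds the weights.
  refine ⟨σ, fun j => ⟨f j, hσ₃ _ _ rfl, fun i hi => ?_⟩, hσ₂, fun i => ?_⟩
  · exact f.lt_iff_lt.1 ((hσ₁ i).trans_lt hi)
  · exact (hb _).trans (hb' (hσ₁ i))

/-- Words in a finite alphabet with monotone weights are well-quasi-ordered by ordered
surjections that preserve letters and do not increase weights. -/
theorem exists_lt_isOrderedSurj {G : Type*} [Finite G] {r : ℕ → ℕ} (b : ∀ n, Fin (r n) → ℕ)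
    (hb : ∀ n, Monotone (b n)) (g : ∀ n, Fin (r n) → G) :
    ∃ m n, m < n ∧ ∃ σ : Fin (r n) → Fin (r m),
      IsOrderedSurj σ ∧ (∀ i, g m (σ i) = g n i) ∧ ∀ i, b m (σ i) ≤ b n i := by
  classical
  -- Letters carry their weight and a first-occurrence flag, so that a Higman embedding preserves
  -- both kinds of data.
  let R : ℕ × G × Prop → ℕ × G × Prop → Prop := fun x y => x.1 ≤ y.1 ∧ x.2 = y.2
  have : IsPreorder (ℕ × G × Prop) R :=
    { refl := fun x => ⟨le_rfl, rfl⟩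
      trans := fun x y z h h' => ⟨h.1.trans h'.1, h.2.trans h'.2⟩ }
  have hR : WellQuasiOrdered R :=
    (wellQuasiOrdered_le (α := ℕ)).prod (Finite.wellQuasiOrdered (α := G × Prop) Eq)
  have hList : WellQuasiOrdered (List.SublistForall₂ R) := by
    have := Set.PartiallyWellOrderedOn.partiallyWellOrderedOn_sublistForall₂ R
      (Set.partiallyWellOrderedOn_univ_iff.2 hR)
    simpa [Set.partiallyWellOrderedOn_univ_iff] using this
  have hSet : WellQuasiOrdered (Eq : Set G → Set G → Prop) := Finite.wellQuasiOrdered _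
  -- An embedding alone allows new letters in the longer word; recording the set of letters used
  -- excludes them.
  obtain ⟨m, n, hmn, hrange, hsub⟩ := (hSet.prod hList) fun n =>
    (Set.range (g n), List.ofFn fun i => (b n i, g n i, IsFirstOccurrence (g n) i))
  refine ⟨m, n, hmn, ?_⟩
  obtain ⟨l, hl, hl'⟩ := List.sublistForall₂_iff.1 hsub
  obtain ⟨f, hf⟩ := List.sublist_iff_exists_fin_orderEmbedding_get_eq.1 hl'
  have hlen := hl.length_eq
  let f' : Fin (r m) ↪o Fin (r n) :=
    ((Fin.castOrderIso (by simpa using hlen)).toOrderEmbedding.trans f).trans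
      (Fin.castOrderIso (by simp)).toOrderEmbedding
  have hf' : ∀ i, R (b m i, g m i, IsFirstOccurrence (g m) i)
      (b n (f' i), g n (f' i), IsFirstOccurrence (g n) (f' i)) := by
    intro i
    have h₁ := hl.get (i := i) (by simp) (by simp [← hlen])
    have h₂ := hf ⟨i, by simp [← hlen]⟩
    simp only [h₂, List.get_ofFn] at h₁
    exact h₁
  exact exists_isOrderedSurj_of_orderEmbedding (hb n) hrange.symm.subset f'
    (fun i => ((Prod.ext_iff.1 (hf' i).2).1).symm) (fun i => (hf' i).1)
    (fun i hi => (Prod.ext_iff.1 (hf' i).2).2.mp hi)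

/-! ### Sorted bases of finite abelian `p`-groups -/

/-- A decomposition of `H` as a direct sum of cyclic groups of orders `p ^ b 0 ≤ p ^ b 1 ≤ ⋯`,
given by generators and their universal property. -/
structure SortedBasis (p : ℕ) (H : Type u) [Group H] where
  /-- the number of generators -/
  rank : ℕ
  /-- the exponents of the orders of the generators -/
  exp : Fin rank → ℕ
  /-- the generators -/
  gen : Fin rank → H
  monotone_exp : Monotone exp
  gen_pow : ∀ i, gen i ^ p ^ exp i = 1
  closure_gen : Subgroup.closure (Set.range gen) = ⊤
  exists_lift : ∀ (K : Type u) [Group K], (∀ x y : K, x * y = y * x) → ∀ g : Fin rank → K,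
    (∀ i, g i ^ p ^ exp i = 1) → ∃ f : H →* K, ∀ i, f (gen i) = g i

theorem exists_monoidHom_pi_zmod {ι : Type*} [Fintype ι] [DecidableEq ι] (n : ι → ℕ)
    {K : Type*} [CommGroup K] (g : ι → K) (hg : ∀ i, g i ^ n i = 1) :
    ∃ f : (∀ i, Multiplicative (ZMod (n i))) →* K,
      ∀ i, f (Pi.mulSingle i (Multiplicative.ofAdd 1)) = g i := by
  let φ : ∀ i, Multiplicative (ZMod (n i)) →* K := fun i =>
    AddMonoidHom.toMultiplicativeLeft (ZMod.lift (n i)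
      ⟨zmultiplesHom (Additive K) (Additive.ofMul (g i)), by
        simp [← ofMul_pow, hg]⟩)
  have hφ : ∀ i, φ i (Multiplicative.ofAdd 1) = g i := by
    intro i
    have := ZMod.lift_coe (n i) ⟨zmultiplesHom (Additive K) (Additive.ofMul (g i)), by
        simp [← ofMul_pow, hg]⟩ 1
    simp only [Int.cast_one] at this
    simp [φ, this]
  refine ⟨∏ i, (φ i).comp (Pi.evalMonoidHom _ i), fun i => ?_⟩
  rw [MonoidHom.finsetProd_apply, Finset.prod_eq_single i]
  · simp [hφ]
  · intro j _ hj
    simp [Pi.mulSingle_eq_of_ne hj]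
  · simp

theorem closure_range_mulSingle_zmod {ι : Type*} [Fintype ι] [DecidableEq ι] (n : ι → ℕ) :
    Subgroup.closure (Set.range fun i =>
      (Pi.mulSingle i (Multiplicative.ofAdd 1) : ∀ i, Multiplicative (ZMod (n i)))) = ⊤ := by
  rw [eq_top_iff]
  rintro x -
  rw [← Finset.univ_prod_mulSingle x]
  refine Subgroup.prod_mem _ fun i _ => ?_
  obtain ⟨z, hz⟩ := ZMod.intCast_surjective (Multiplicative.toAdd (x i))
  have : x i = (Multiplicative.ofAdd (1 : ZMod (n i))) ^ z := by
    rw [← ofAdd_zsmul, zsmul_one, hz, ofAdd_toAdd]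
  rw [this, Pi.mulSingle_zpow]
  exact Subgroup.zpow_mem _ (Subgroup.subset_closure (Set.mem_range_self i)) z

theorem nonempty_sortedBasis {p : ℕ} (hp : p.Prime) (H : Type u) [Group H] [Finite H]
    (hcomm : ∀ x y : H, x * y = y * x) (hH : IsPGroup p H) : Nonempty (SortedBasis p H) := by
  classical
  have : Fact p.Prime := ⟨hp⟩
  let _ : CommGroup H := { ‹Group H› with mul_comm := hcomm }
  obtain ⟨ι, _, n, -, ⟨E⟩⟩ := CommGroup.equiv_prod_multiplicative_zmod_of_finite H
  let e : ι → H := fun i => E.symm (Pi.mulSingle i (Multiplicative.ofAdd 1))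
  -- Some `p ^ a` kills the generator `e i`, whose order is `n i`; hence `n i` divides `p ^ a`.
  have hn : ∀ i, ∃ b, n i = p ^ b := by
    intro i
    obtain ⟨a, ha⟩ := hH (e i)
    have h₁ : (Pi.mulSingle i (Multiplicative.ofAdd (1 : ZMod (n i))) :
        ∀ i, Multiplicative (ZMod (n i))) ^ p ^ a = 1 := by
      apply E.symm.injective
      rw [map_one E.symm, map_pow E.symm]
      exact ha
    have h₂ := congrFun h₁ i
    simp only [Pi.pow_apply, Pi.mulSingle_eq_same, Pi.one_apply, ← ofAdd_nsmul,
      ofAdd_eq_one, nsmul_one] at h₂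
    obtain ⟨b, -, hb⟩ := (Nat.dvd_prime_pow hp).1 ((ZMod.natCast_eq_zero_iff _ _).1 h₂)
    exact ⟨b, hb⟩
  choose b hb using hn
  let τ := (Tuple.sort (b ∘ (Fintype.equivFin ι).symm)).trans (Fintype.equivFin ι).symm
  refine ⟨⟨Fintype.card ι, b ∘ τ, e ∘ τ,
    Tuple.monotone_sort (b ∘ (Fintype.equivFin ι).symm), fun i => ?_, ?_, ?_⟩⟩
  · simp only [Function.comp_apply, e, ← map_pow, ← hb, ← Pi.mulSingle_pow, ← ofAdd_nsmul]
    simp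
  · rw [τ.surjective.range_comp]
    have := congrArg (Subgroup.map E.symm.toMonoidHom) (closure_range_mulSingle_zmod n)
    rw [MonoidHom.map_closure, ← Set.range_comp,
      Subgroup.map_top_of_surjective _ E.symm.surjective] at this
    exact this
  · intro K _ hK g hg
    let _ : CommGroup K := { ‹Group K› with mul_comm := hK }
    obtain ⟨f, hf⟩ := exists_monoidHom_pi_zmod n (g ∘ τ.symm) fun i => by
      simpa [hb] using hg (τ.symm i)
    exact ⟨f.comp E.toMonoidHom, fun i => by simp [e, hf]⟩

/-! ### Leading terms -/

/-- The leading term of a finitely supported function is the largest element of its support. -/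
def IsLeadingTerm {α k : Type*} [LinearOrder α] [Zero k] (x : α →₀ k) (a : α) : Prop :=
  IsGreatest (x.support : Set α) a

theorem exists_isLeadingTerm {α k : Type*} [LinearOrder α] [Zero k] {x : α →₀ k} (hx : x ≠ 0) :
    ∃ a, IsLeadingTerm x a :=
  ⟨_, x.support.isGreatest_max' (Finsupp.support_nonempty_iff.2 hx)⟩

theorem IsLeadingTerm.mapDomain {α β k : Type*} [LinearOrder α] [LinearOrder β] [AddCommMonoid k]
    {x : α →₀ k} {a : α} (h : IsLeadingTerm x a) {f : α → β} (hf : StrictMono f) :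
    IsLeadingTerm (x.mapDomain f) (f a) := by
  classical
  rw [IsLeadingTerm, Finsupp.mapDomain_support_of_injective hf.injective, Finset.coe_image]
  exact hf.monotone.map_isGreatest h

/-- One reduction step: the scalar cancels the coefficients at `a`, and both functions vanish above
`a`. -/
theorem IsLeadingTerm.lt_of_sub {α k : Type*} [LinearOrder α] [Field k]
    {x y : α →₀ k} {a b : α} (hx : IsLeadingTerm x a) (hy : IsLeadingTerm y a)
    (hb : IsLeadingTerm (x - (x a / y a) • y) b) : b < a := by
  classical
  have hya : y a ≠ 0 := Finsupp.mem_support_iff.1 hy.1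
  have hb₁ := Finsupp.mem_support_iff.1 hb.1
  refine lt_of_le_of_ne ?_ ?_
  · by_contra! hlt
    have h₁ : x b = 0 := Finsupp.notMem_support_iff.1 fun h => (hx.2 h).not_gt hlt
    have h₂ : y b = 0 := Finsupp.notMem_support_iff.1 fun h => (hy.2 h).not_gt hlt
    simp [h₁, h₂] at hb₁
  · rintro rfl
    simp [hya] at hb₁

/-- If the morphisms to `G` are well-quasi-ordered by strictly monotone precompositions, then
every subfunctor of the linearised representable functor of `G` is finitely generated. -/
theorem exists_finite_generators {C : Type*} [Category C] (k : Type*) [Field k] (G : C)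
    [∀ H : C, LinearOrder (H ⟶ G)] [∀ H : C, Finite (H ⟶ G)]
    (hwqo : WellQuasiOrdered fun a a' : Σ H : C, (H ⟶ G) =>
      ∃ φ : a'.1 ⟶ a.1, φ ≫ a.2 = a'.2 ∧ StrictMono fun b : a.1 ⟶ G => φ ≫ b)
    (M : ∀ H : C, Submodule k ((H ⟶ G) →₀ k))
    (hM : ∀ {H H' : C} (φ : H' ⟶ H), ∀ x ∈ M H, x.mapDomain (φ ≫ ·) ∈ M H') :
    ∃ (n : ℕ) (K : Fin n → C) (x : ∀ i, (K i ⟶ G) →₀ k), (∀ i, x i ∈ M (K i)) ∧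
      ∀ N : ∀ H : C, Submodule k ((H ⟶ G) →₀ k),
        (∀ {H H' : C} (φ : H' ⟶ H), ∀ x ∈ N H, x.mapDomain (φ ≫ ·) ∈ N H') →
        (∀ i, x i ∈ N (K i)) → ∀ H, M H ≤ N H := by
  obtain ⟨t, ht, hbasis⟩ := hwqo.exists_finset_basis {a | ∃ x ∈ M a.1, IsLeadingTerm x a.2}
  choose x hxM hx using fun a : t => ht a.1 a.2
  let E := t.equivFin
  refine ⟨t.card, fun i => (E.symm i).1.1, fun i => x (E.symm i), fun i => hxM _, ?_⟩
  intro N hN hxN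
  have hxN' : ∀ a : t, x a ∈ N a.1.1 := fun a => by
    obtain ⟨i, rfl⟩ := E.symm.surjective a
    exact hxN i
  have key : ∀ H (a : H ⟶ G), ∀ y ∈ M H, IsLeadingTerm y a → y ∈ N H := by
    intro H a
    -- Reduction terminates because `H ⟶ G` is finite. At each step a generator is moved to `H` so
    -- that its leading term becomes `a`, and a multiple of it is subtracted.
    induction a using WellFoundedLT.induction with
    | _ a ih =>
      intro y hyM hy
      obtain ⟨c, hct, φ, hφ, hmono⟩ := hbasis ⟨H, a⟩ ⟨y, hyM, hy⟩
      let z := (x ⟨c, hct⟩).mapDomain (φ ≫ ·)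
      have hz : IsLeadingTerm z a := by
        have := (hx ⟨c, hct⟩).mapDomain hmono
        rwa [hφ] at this
      have hzM : z ∈ M H := hM φ _ (hxM ⟨c, hct⟩)
      have hzN : z ∈ N H := hN φ _ (hxN' ⟨c, hct⟩)
      have hsub : y - (y a / z a) • z ∈ N H := by
        by_cases h0 : y - (y a / z a) • z = 0
        · rw [h0]
          exact zero_mem _
        · obtain ⟨b, hb⟩ := exists_isLeadingTerm h0
          exact ih b (hy.lt_of_sub hz hb) _
            (sub_mem hyM (Submodule.smul_mem _ _ hzM)) hb
      simpa using add_mem hsub (Submodule.smul_mem _ (y a / z a) hzN)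
  intro H y hy
  by_cases h0 : y = 0
  · rw [h0]
    exact zero_mem _
  · obtain ⟨a, ha⟩ := exists_isLeadingTerm h0
    exact key H a y hy ha

/-! ### Words of morphisms to an abelian group -/

namespace OutGrp

/-- The values of a morphism to a commutative group on a family of elements. -/
def word {G H : OutGrp.{u}} (hG : ∀ x y : G, x * y = y * x) {r : ℕ} (e : Fin r → H) :
    (H ⟶ G) → Fin r → G :=
  Quotient.lift (fun f i => f.1 (e i)) (by
    rintro f g ⟨h, hg⟩
    funext i
    simp [hg, hG h])

theorem word_injective {G H : OutGrp.{u}} (hG : ∀ x y : G, x * y = y * x) {r : ℕ}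
    {e : Fin r → H} (he : Subgroup.closure (Set.range e) = ⊤) :
    Function.Injective (word hG e) := by
  rintro ⟨f⟩ ⟨g⟩ hfg
  have : f.1 = g.1 := MonoidHom.eq_of_eqOn_dense he (by
    rintro _ ⟨i, rfl⟩
    exact congrFun hfg i)
  rw [Subtype.ext this]

/-- A surjection of generators that does not increase orders induces a surjection of groups. -/
theorem exists_hom_word_comp {p : ℕ} {H H' : OutGrp.{u}} (B : SortedBasis p H)
    (B' : SortedBasis p H') (hH : ∀ x y : H, x * y = y * x) {σ : Fin B'.rank → Fin B.rank}
    (hσ : Function.Surjective σ) (hexp : ∀ i, B.exp (σ i) ≤ B'.exp i) :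
    ∃ φ : H' ⟶ H, ∀ (G : OutGrp.{u}) (hG : ∀ x y : G, x * y = y * x) (a : H ⟶ G),
      word hG B'.gen (φ ≫ a) = word hG B.gen a ∘ σ := by
  -- The order of `B.gen (σ i)` divides `p ^ B.exp (σ i)`, hence also `p ^ B'.exp i`.
  obtain ⟨f, hf⟩ := B'.exists_lift H hH (B.gen ∘ σ) fun i => by
    obtain ⟨c, hc⟩ := pow_dvd_pow p (hexp i)
    simp [hc, pow_mul, B.gen_pow]
  have hsurj : Function.Surjective f := by
    rw [← MonoidHom.range_eq_top, eq_top_iff, ← B.closure_gen, Subgroup.closure_le]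
    rintro _ ⟨j, rfl⟩
    obtain ⟨i, rfl⟩ := hσ j
    exact ⟨B'.gen i, hf i⟩
  refine ⟨Quotient.mk _ ⟨f, hsurj⟩, ?_⟩
  rintro G hG ⟨a⟩
  funext i
  exact congrArg a.1 (hf i)

end OutGrp

/-! ### Generation by elements in the functor category -/

/-- The morphism `e_G ⟶ X` that corresponds to an element of `X G`. -/
noncomputable def repDesc {k : Type u} [Field k] {U : ObjectProperty OutGrp.{u}}
    {X : FunctorCat.{u} k U} {G : U.FullSubcategory} (s : X.obj (.op G)) : repObj k U G ⟶ X where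
  app H := ModuleCat.freeDesc (TypeCat.ofHom fun f : H.unop ⟶ G => X.map f.op s)
  naturality H H' φ := by
    apply ModuleCat.free_hom_ext
    intro f
    have h₁ : (ModuleCat.free k).map ((yoneda.obj G).map φ) (ModuleCat.freeMk f) =
        ModuleCat.freeMk (φ.unop ≫ f) := ModuleCat.free_map_apply _ _
    have h₂ : X.map (φ.unop ≫ f).op s = X.map φ (X.map f.op s) := by simp
    have h₃ := ModuleCat.freeDesc_apply
      (TypeCat.ofHom fun f : H.unop ⟶ G => X.map f.op s) f
    exact (congrArg _ h₁).trans ((ModuleCat.freeDesc_apply _ _).trans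
      (h₂.trans (congrArg (X.map φ) h₃.symm)))

/-- The universal element of `e_G`. -/
noncomputable def repOne (k : Type u) [Field k] {U : ObjectProperty OutGrp.{u}}
    (G : U.FullSubcategory) : (repObj k U G).obj (.op G) :=
  ModuleCat.freeMk (X := G ⟶ G) (𝟙 G)

theorem repDesc_repOne {k : Type u} [Field k] {U : ObjectProperty OutGrp.{u}}
    {X : FunctorCat.{u} k U} {G : U.FullSubcategory} (s : X.obj (.op G)) :
    (repDesc s).app (.op G) (repOne k G) = s :=
  (ModuleCat.freeDesc_apply _ _).trans (by simp)

/-- The subfunctor of `e_G` that a subobject defines, in a given degree. -/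
noncomputable def imageSubmodule {k : Type u} [Field k] {U : ObjectProperty OutGrp.{u}}
    {G : U.FullSubcategory} {X : FunctorCat.{u} k U} (f : X ⟶ repObj k U G)
    (H : U.FullSubcategory) : Submodule k ((H ⟶ G) →₀ k) :=
  LinearMap.range (f.app (.op H)).hom

theorem mapDomain_mem_imageSubmodule {k : Type u} [Field k] {U : ObjectProperty OutGrp.{u}}
    {G : U.FullSubcategory} {X : FunctorCat.{u} k U} (f : X ⟶ repObj k U G)
    {H H' : U.FullSubcategory} (φ : H' ⟶ H) (x : (H ⟶ G) →₀ k) (hx : x ∈ imageSubmodule f H) :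
    x.mapDomain (φ ≫ ·) ∈ imageSubmodule f H' := by
  obtain ⟨y, rfl⟩ := hx
  exact ⟨X.map φ.op y, NatTrans.naturality_apply f φ.op y⟩

/-- By Yoneda, the finitely many generators of the image of a subobject `S` define a map from a sum
of representables to `S`. Its image in `e_G` contains the generators, hence all of the image of `S`;
as `S.arrow` is mono, the map is onto `S`. -/
theorem isNoetherianObj_repObj {k : Type u} [Field k] {U : ObjectProperty OutGrp.{u}}
    (G : U.FullSubcategory) [∀ H : U.FullSubcategory, LinearOrder (H ⟶ G)]
    [∀ H : U.FullSubcategory, Finite (H ⟶ G)]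
    (hwqo : WellQuasiOrdered fun a a' : Σ H : U.FullSubcategory, (H ⟶ G) =>
      ∃ φ : a'.1 ⟶ a.1, φ ≫ a.2 = a'.2 ∧ StrictMono fun b : a.1 ⟶ G => φ ≫ b) :
    IsNoetherianObj (repObj k U G) := by
  intro S
  obtain ⟨n, K, x, hx, hgen⟩ := exists_finite_generators k G hwqo (imageSubmodule S.arrow)
    (mapDomain_mem_imageSubmodule S.arrow)
  choose s hs using hx
  let F : (∐ fun i => repObj k U (K i)) ⟶ (S : FunctorCat.{u} k U) :=
    Sigma.desc fun i => repDesc (s i)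
  have hF : ∀ i, F.app (.op (K i)) ((Sigma.ι (fun i => repObj k U (K i)) i).app (.op (K i))
      (repOne k (K i))) = s i := by
    intro i
    rw [← ConcreteCategory.comp_apply, ← NatTrans.comp_app, Sigma.ι_desc, repDesc_repOne]
  have hle := hgen (imageSubmodule (F ≫ S.arrow)) (mapDomain_mem_imageSubmodule _) (fun i => by
    rw [← hs i, ← hF i]
    exact ⟨_, rfl⟩)
  refine ⟨n, K, F, ?_⟩
  have : ∀ H, Epi (F.app H) := by
    intro H
    rw [ModuleCat.epi_iff_surjective]
    intro y
    obtain ⟨z, hz⟩ := hle H.unop ⟨y, rfl⟩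
    exact ⟨z, (ModuleCat.mono_iff_injective (S.arrow.app H)).1 inferInstance hz⟩
  exact NatTrans.epi_of_epi_app F

/-! ### The main theorem -/

theorem isLocallyNoetherian_of_le_abelianPGroups (k : Type u) [Field k] {p : ℕ} (hp : p.Prime)
    {U : ObjectProperty OutGrp.{u}} (hU : U ≤ abelianPGroups.{u} p) :
    IsLocallyNoetherian.{u} k U := by
  classical
  intro G
  have hcomm : ∀ H : U.FullSubcategory, ∀ x y : H.obj, x * y = y * x := fun H => (hU _ H.2).1
  let B : ∀ H : U.FullSubcategory, SortedBasis p H.obj := fun H =>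
    (nonempty_sortedBasis hp _ (hcomm H) (hU _ H.2).2).some
  let w : ∀ H : U.FullSubcategory, (H ⟶ G) → Fin (B H).rank → G.obj := fun H a =>
    OutGrp.word (hcomm G) (B H).gen a.hom
  have hw : ∀ H, Function.Injective (w H) := fun H a b hab =>
    InducedCategory.Hom.ext (OutGrp.word_injective (hcomm G) (B H).closure_gen hab)
  -- Any linear order on the alphabet will do.
  let _ : LinearOrder G.obj := LinearOrder.lift' _ (Finite.equivFin G.obj).injective
  let _ : ∀ H : U.FullSubcategory, LinearOrder (H ⟶ G) := fun H =>
    LinearOrder.lift' (fun a => toLex (w H a)) (toLex.injective.comp (hw H))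
  have : ∀ H : U.FullSubcategory, Finite (H ⟶ G) := fun H => Finite.of_injective _ (hw H)
  refine isNoetherianObj_repObj G fun a => ?_
  obtain ⟨m, n, hmn, σ, hσ, hg, hexp⟩ := exists_lt_isOrderedSurj
    (fun n => (B (a n).1).exp) (fun n => (B (a n).1).monotone_exp) (fun n => w _ (a n).2)
  obtain ⟨φ, hφ⟩ := OutGrp.exists_hom_word_comp (B (a m).1) (B (a n).1) (hcomm _)
    hσ.surjective hexp
  have hwφ : ∀ b : (a m).1 ⟶ G, w _ (ObjectProperty.homMk φ ≫ b) = w _ b ∘ σ :=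
    fun b => hφ _ (hcomm G) b.hom
  refine ⟨m, n, hmn, ObjectProperty.homMk φ, hw _ ((hwφ _).trans (funext hg)), fun b c hbc => ?_⟩
  change toLex (w _ _) < toLex (w _ _)
  rw [hwφ, hwφ]
  exact hσ.lex_lt hbc

theorem mainTheorem1 (k : Type u) [Field k] [CharZero k] (p : ℕ) (hp : p.Prime) :
    IsLocallyNoetherian.{u} k (abelianPGroups.{u} p) ∧
    (∀ n : ℕ, 1 ≤ n → IsLocallyNoetherian.{u} k (abelianOfExponentDvd.{u} (p ^ n))) ∧
    (∀ U : ObjectProperty OutGrp.{u}, IsMultiplicative U → IsGlobalFamily U →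
      U ≤ abelianPGroups.{u} p → IsLocallyNoetherian.{u} k U) := by
  refine ⟨isLocallyNoetherian_of_le_abelianPGroups k hp le_rfl, fun n _ => ?_,
    fun U _ _ hU => isLocallyNoetherian_of_le_abelianPGroups k hp hU⟩
  refine isLocallyNoetherian_of_le_abelianPGroups k hp fun G hG => ⟨hG.1, fun x => ⟨n, ?_⟩⟩
  exact orderOf_dvd_iff_pow_eq_one.1 ((Monoid.order_dvd_exponent x).trans hG.2)
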